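/- Let $m_1,m_2,m_3,r$ be non-negative integers with $m_3\ge 2$. Let $\mathcal S\subset\mathbb R^{m_1\times m_2\times m_3}$ be the set of tensors of rank exactly one, with the Frobenius norm on tensors and the Euclidean product norm on $r$-tuples of tensors, and let $\Phi_r:\mathcal S^{\times r}\to\mathbb R^{m_1\times m_2\times m_3}$, $\Phi_r(\mathcal A_1,\dots,\mathcal A_r)=\mathcal A_1+\cdots+\mathcal A_r$. For $\mathfrak a=(\mathcal A_1,\dots,\mathcal A_r)\in\mathcal S^{\times r}$ and $\mathcal A=\Phi_r(\mathfrak a)$, a local inverse of $\Phi_r$ at $\mathfrak a$ is a continuous map $\Phi_{\mathfrak a}^{-1}:\Phi_r(U)\to U$ inverse to $\Phi_r|_U$, for some neighbourhood $U$ of $\mathfrak a$ in $\mathcal S^{\times r}$. The condition number is $$\kappa(\mathcal A_1,\dots,\mathcal A_r)=\lim_{\epsilon\to0^+}\ \sup_{\substack{\mathcal B\in\Phi_r(U),\\ 0<\|\mathcal A-\mathcal B\|_F<\epsilon}}\frac{\|\Phi_{\mathfrak a}^{-1}(\mathcal A)-\Phi_{\mathfrak a}^{-1}(\mathcal B)\|_F}{\|\mathcal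 A-\mathcal B\|_F}\in[0,\infty]$$ (independent of the choice of the local inverse; the supremum of the empty set is $0$), and $\kappa(\mathcal A_1,\dots,\mathcal A_r)=\infty$ if no local inverse exists, which includes the case that some $\mathcal A_i$ is $0$. **Theorem.** Let $m_3\ge2$. There are real numbers $T_{r,\alpha}$ ($r\in\mathbb N$, $\alpha>0$), depending only on $m_3,r,\alpha$, such that the following holds. 1. Let $m_1,m_2,r$ be arbitrary, let $\mathbf a_1,\dots,\mathbf a_r\in\mathbb R^{m_1}$ and $\mathbf b_1,\dots,\mathbf b_r\in\mathbb R^{m_2}$ be arbitrary and fixed, let $\mathbf c_1,\dots,\mathbf c_r\in\mathbb R^{m_3}$ be independent standard Gaussian random vectors (on any probability space), and let $\mathcal A_i=\mathbf a_i\otimes\mathbf b_i\otimes\mathbf c_i\in\mathbb R^{m_1\times m_2\times m_3}$. Then for every $\alpha>0$ $$\mathrm P\Big[\kappa(\mathcal A_1,\dots,\mathcal A_r)\ge\alpha\, r^{\frac{2}{m_3-1}}\Big]\ \ge\ T_{r,\alpha}.$$ 2. For every $\alpha>0$, $$\lim_{r\to\infty}T_{r,\alpha}=1-e^{-K\alpha^{1-m_3}},\qquad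 K=\frac{2^{\frac12(m_3-5)}}{\sqrt\pi}\,\frac{\Gamma(\frac{m_3}{2})}{\Gamma(\frac{m_3+1}{2})},$$ where $\Gamma$ is the gamma function. 3. In particular, if $m_3=2$, then for every $\alpha>0$ one has $\mathrm P[\kappa(\mathcal A_1,\dots,\mathcal A_r)\ge\alpha r^2]\ge T_{r,\alpha}$ and $\lim_{r\to\infty}T_{r,\alpha}=1-e^{-\frac1{\sqrt2\,\pi\alpha}}$; moreover $1-e^{-\frac1{\sqrt2\,\pi\alpha}}\sim\frac1{\sqrt2\,\pi\alpha}$ as $\alpha\to\infty$. -/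

import Mathlib

open MeasureTheory ProbabilityTheory Filter Topology Asymptotics
open scoped ENNReal

universe u

/-- `m₁ × m₂ × m₃` real tensors with the Euclidean (Frobenius) norm. -/
abbrev Tensor3 (m₁ m₂ m₃ : ℕ) : Type :=
  EuclideanSpace ℝ (Fin m₁ × Fin m₂ × Fin m₃)

/-- The tensor `a ⊗ b ⊗ c`. -/
noncomputable def outer {m₁ m₂ m₃ : ℕ} (a : EuclideanSpace ℝ (Fin m₁))
    (b : EuclideanSpace ℝ (Fin m₂)) (c : EuclideanSpace ℝ (Fin m₃)) : Tensor3 m₁ m₂ m₃ :=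
  WithLp.toLp 2 fun p => a p.1 * b p.2.1 * c p.2.2

/-- The Segre manifold `S` of tensors of rank (exactly) one. -/
def segre (m₁ m₂ m₃ : ℕ) : Set (Tensor3 m₁ m₂ m₃) :=
  {A | A ≠ 0 ∧ ∃ a b c, A = outer a b c}

/-- Ordered `r`-tuples of tensors with the Euclidean norm of the product. -/
abbrev TensorTuple (r m₁ m₂ m₃ : ℕ) : Type :=
  PiLp 2 fun _ : Fin r => Tensor3 m₁ m₂ m₃

/-- The product `S ^ r`. -/
def segrePow (r m₁ m₂ m₃ : ℕ) : Set (TensorTuple r m₁ m₂ m₃) :=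
  {t | ∀ i, t i ∈ segre m₁ m₂ m₃}

/-- The addition map `Φ_r (A₁, …, A_r) = A₁ + ⋯ + A_r`. -/
noncomputable def addMap {r m₁ m₂ m₃ : ℕ} (t : TensorTuple r m₁ m₂ m₃) : Tensor3 m₁ m₂ m₃ :=
  ∑ i, t i

/-- `Ψ`, with domain `Φ_r(U)`, is a local inverse of `Φ_r : S ^ r → ℝ^{m₁ × m₂ × m₃}` at `t`:
`U` is a neighbourhood of `t` in `S ^ r`, and `Φ_r : U → Φ_r(U)` has the continuous inverse `Ψ`.
In particular `Ψ (Φ_r t) = t`. (Values of `Ψ` outside `Φ_r(U)` are never used.) -/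
structure IsLocalInverse {r m₁ m₂ m₃ : ℕ} (t : TensorTuple r m₁ m₂ m₃)
    (U : Set (TensorTuple r m₁ m₂ m₃)) (Ψ : Tensor3 m₁ m₂ m₃ → TensorTuple r m₁ m₂ m₃) :
    Prop where
  mem : t ∈ U
  subset : U ⊆ segrePow r m₁ m₂ m₃
  nhds : U ∈ 𝓝[segrePow r m₁ m₂ m₃] t
  left_inv : ∀ u ∈ U, Ψ (addMap u) = u
  continuousOn : ContinuousOn Ψ (addMap '' U)

/-- The limit, as `ε → 0⁺`, of the supremum of `‖Ψ A - Ψ B‖ / ‖A - B‖` over all `B ≠ A` in the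
domain `Φ_r(U)` of `Ψ` with `‖A - B‖ < ε`, where `A = Φ_r(t)`. As the supremum is monotone in `ε`,
the limit is the infimum over `ε > 0`. -/
noncomputable def localCond {r m₁ m₂ m₃ : ℕ} (t : TensorTuple r m₁ m₂ m₃)
    (U : Set (TensorTuple r m₁ m₂ m₃)) (Ψ : Tensor3 m₁ m₂ m₃ → TensorTuple r m₁ m₂ m₃) :
    ℝ≥0∞ :=
  ⨅ (ε : ℝ) (_ : 0 < ε), ⨆ (B : Tensor3 m₁ m₂ m₃)
    (_ : B ∈ addMap '' U ∧ B ≠ addMap t ∧ ‖addMap t - B‖ < ε),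
    ENNReal.ofReal (‖Ψ (addMap t) - Ψ B‖ / ‖addMap t - B‖)

/-- The condition number `κ(A₁, …, A_r)` of the tensor rank decomposition: `localCond` for any
local inverse of `Φ_r` at the tuple (the value does not depend on the choice, see
`condNumber_eq`), and `∞` if there is no local inverse (infimum of the empty family). -/
noncomputable def condNumber {r m₁ m₂ m₃ : ℕ} (t : TensorTuple r m₁ m₂ m₃) : ℝ≥0∞ :=
  ⨅ (U : Set (TensorTuple r m₁ m₂ m₃)) (Ψ : Tensor3 m₁ m₂ m₃ → TensorTuple r m₁ m₂ m₃)
    (_ : IsLocalInverse t U Ψ), localCond t U Ψ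

theorem localCond_le {r m₁ m₂ m₃ : ℕ} {t : TensorTuple r m₁ m₂ m₃}
    {U U' : Set (TensorTuple r m₁ m₂ m₃)} {Ψ Ψ' : Tensor3 m₁ m₂ m₃ → TensorTuple r m₁ m₂ m₃}
    (h : IsLocalInverse t U Ψ) (h' : IsLocalInverse t U' Ψ') :
    localCond t U' Ψ' ≤ localCond t U Ψ := by
  have hA : Ψ (addMap t) = t := h.left_inv t h.mem
  have hA' : Ψ' (addMap t) = t := h'.left_inv t h'.mem
  have hc : Tendsto Ψ' (𝓝[addMap '' U'] (addMap t)) (𝓝[segrePow r m₁ m₂ m₃] t) := by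
    refine tendsto_nhdsWithin_iff.2 ⟨?_, ?_⟩
    · have := h'.continuousOn (addMap t) ⟨t, h'.mem, rfl⟩
      rwa [ContinuousWithinAt, hA'] at this
    · filter_upwards [self_mem_nhdsWithin] with B hB
      obtain ⟨u, hu, rfl⟩ := hB
      rw [h'.left_inv u hu]
      exact h'.subset hu
  obtain ⟨δ, hδ, hball⟩ := Metric.mem_nhdsWithin_iff.1 (hc h.nhds)
  refine le_iInf₂ fun ε hε => ?_
  refine (iInf₂_le (min ε δ) (lt_min hε hδ)).trans ?_
  refine iSup₂_le fun B hB => ?_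
  obtain ⟨⟨u, hu, rfl⟩, hne, hlt⟩ := hB
  have huU : u ∈ U := by
    have : addMap u ∈ Ψ' ⁻¹' U := hball
      ⟨by rw [Metric.mem_ball, dist_comm, dist_eq_norm]; exact hlt.trans_le (min_le_right _ _),
        ⟨u, hu, rfl⟩⟩
    rwa [Set.mem_preimage, h'.left_inv u hu] at this
  refine le_trans (le_of_eq ?_) (le_iSup₂ (addMap u)
    ⟨⟨u, huU, rfl⟩, hne, hlt.trans_le (min_le_left _ _)⟩)
  rw [hA, hA', h.left_inv u huU, h'.left_inv u hu]

/-- The condition number may be computed with any local inverse. -/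
theorem condNumber_eq {r m₁ m₂ m₃ : ℕ} {t : TensorTuple r m₁ m₂ m₃}
    {U : Set (TensorTuple r m₁ m₂ m₃)} {Ψ : Tensor3 m₁ m₂ m₃ → TensorTuple r m₁ m₂ m₃}
    (h : IsLocalInverse t U Ψ) : condNumber t = localCond t U Ψ :=
  le_antisymm (iInf_le_of_le U (iInf₂_le Ψ h))
    (le_iInf fun _ => le_iInf₂ fun _ h' => localCond_le h' h)

/-- The tuple `(a₁ ⊗ b₁ ⊗ c₁, …, a_r ⊗ b_r ⊗ c_r)`. -/
noncomputable def cpdTuple {r m₁ m₂ m₃ : ℕ} (a : Fin r → EuclideanSpace ℝ (Fin m₁))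
    (b : Fin r → EuclideanSpace ℝ (Fin m₂)) (c : Fin r → EuclideanSpace ℝ (Fin m₃)) :
    TensorTuple r m₁ m₂ m₃ :=
  WithLp.toLp 2 fun i => outer (a i) (b i) (c i)

/-- `K = 2 ^ ((m₃ - 5) / 2) / √π * Γ(m₃ / 2) / Γ((m₃ + 1) / 2)`. -/
noncomputable def constK (m₃ : ℕ) : ℝ :=
  (2 : ℝ) ^ (((m₃ : ℝ) - 5) / 2) / √Real.pi *
    (Real.Gamma ((m₃ : ℝ) / 2) / Real.Gamma (((m₃ : ℝ) + 1) / 2))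

/-!
The condition number is large as soon as two of the third factors `c i`, `c j` point in nearly the
same direction, whatever the other factors are. Indeed, `a j ⊗ b i ⊗ c i` is a tangent direction of
the Segre manifold at the `i`-th summand (move `a i`), and `a j ⊗ b i ⊗ c j` is one at the `j`-th
summand (move `b j`). After normalization of `c i` and `c j`, the two unit speed motions in opposite
directions change the tuple at speed `√2`, but its sum only at speed `‖ĉ i - ĉ j‖`; both
motions are along straight lines, so that no differential calculus is needed
(`le_condNumber_of_line`, `le_condNumber_of_close`).

It remains to bound below the probability that some two of `r` independent Gaussian vectors in
`ℝ^(m+1)`, `m = m₃ - 1`, have an angle of tangent at most `ρ = √2 / (α r ^ (2 / m))`. By rotation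
invariance, each pair is close with the same probability `p`, also conditionally on one of the two
vectors, and slicing the cone orthogonally to its axis gives `p ∼ C ρ ^ m`
(`tendsto_coneProb_div_pow`). The vectors are added one at a time. By the second Bonferroni
inequality, the `k + 1`-st vector is far from `k` pairwise far ones with probability at most
`1 - k p`, up to an error of `k² p²`; hence the probability that there is no close pair is at most
`exp (-r (r - 1) p / 2) + r³ p²` (`measureReal_pairFree_le`). As `r² p / 2` tends to
`K α ^ (-m)`, the first term tends to `exp (-K α ^ (-m))` and the second one to `0`.
-/

/-! ### Vectors in nearly the same direction -/

/-- `Close τ x y` says that `x` and `y` are nonzero and that the angle between them is at most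
`arctan τ`. -/
def Close {E : Type*} [NormedAddCommGroup E] [InnerProductSpace ℝ E] (τ : ℝ) (x y : E) : Prop :=
  0 < inner ℝ x y ∧ ‖x‖ ^ 2 * ‖y‖ ^ 2 ≤ (1 + τ ^ 2) * inner ℝ x y ^ 2

section

variable {E F : Type*} [NormedAddCommGroup E] [InnerProductSpace ℝ E] [NormedAddCommGroup F]
  [InnerProductSpace ℝ F] {τ : ℝ} {x y : E}

theorem Close.symm (h : Close τ x y) : Close τ y x := by
  rw [Close, real_inner_comm]
  exact ⟨h.1, by linarith [h.2, mul_comm (‖x‖ ^ 2) (‖y‖ ^ 2)]⟩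

theorem close_map_iff (f : E ≃ₗᵢ[ℝ] F) : Close τ (f x) (f y) ↔ Close τ x y := by
  simp [Close]

theorem close_smul_left_iff {s : ℝ} (hs : 0 < s) : Close τ (s • x) y ↔ Close τ x y := by
  rw [Close, Close, real_inner_smul_left, norm_smul, Real.norm_of_nonneg hs.le, mul_pow, mul_pow,
    mul_pos_iff_of_pos_left hs, mul_assoc, mul_left_comm (1 + τ ^ 2),
    mul_le_mul_iff_right₀ (by positivity)]

theorem Close.ne_zero_left (h : Close τ x y) : x ≠ 0 := by
  rintro rfl; simp [Close] at h

/-- The chord of an angle is at most its tangent. -/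
theorem Close.norm_sub_le (hτ : 0 ≤ τ) (h : Close τ x y) :
    ‖(‖x‖⁻¹) • x - (‖y‖⁻¹) • y‖ ≤ τ := by
  have hx : 0 < ‖x‖ := norm_pos_iff.2 h.ne_zero_left
  have hy : 0 < ‖y‖ := norm_pos_iff.2 h.symm.ne_zero_left
  refine abs_le_of_sq_le_sq' ?_ hτ |>.2
  have hxy : 0 < ‖x‖ * ‖y‖ := by positivity
  set u : ℝ := inner ℝ x y / (‖x‖ * ‖y‖) with hu
  have hu0 : 0 < u := div_pos h.1 hxy
  have hu1 : u ≤ 1 := (div_le_one hxy).2 (real_inner_le_norm x y)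
  have hin : inner ℝ x y = u * (‖x‖ * ‖y‖) := by rw [hu]; field_simp
  have huτ : 1 ≤ (1 + τ ^ 2) * u ^ 2 := by
    have h2 := h.2
    rw [hin] at h2
    refine le_of_mul_le_mul_right ?_ (pow_pos hxy 2)
    linarith
  rw [norm_sub_sq_real, real_inner_smul_left, real_inner_smul_right, norm_smul, norm_smul, hin,
    norm_inv, norm_inv, norm_norm, norm_norm, inv_mul_cancel₀ hx.ne', inv_mul_cancel₀ hy.ne']
  have : ‖x‖⁻¹ * (‖y‖⁻¹ * (u * (‖x‖ * ‖y‖))) = u := by field_simp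
  rw [this]
  have h3 : 0 ≤ (1 - u) * (1 + u - 2 * u ^ 2) := by
    rw [show (1 - u) * (1 + u - 2 * u ^ 2) = (1 - u) ^ 2 * (1 + 2 * u) by ring]; positivity
  nlinarith [sq_nonneg τ, pow_pos hu0 2]

end

/-! ### Lower bounds for the condition number -/

theorem norm_outer {m₁ m₂ m₃ : ℕ} (a : EuclideanSpace ℝ (Fin m₁))
    (b : EuclideanSpace ℝ (Fin m₂)) (c : EuclideanSpace ℝ (Fin m₃)) :
    ‖outer a b c‖ = ‖a‖ * ‖b‖ * ‖c‖ := by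
  rw [← sq_eq_sq₀ (norm_nonneg _) (by positivity), mul_pow, mul_pow]
  simp only [EuclideanSpace.real_norm_sq_eq, outer, mul_pow]
  rw [Finset.sum_mul_sum, Finset.sum_mul, Fintype.sum_prod_type]
  refine Finset.sum_congr rfl fun i _ => ?_
  rw [Fintype.sum_prod_type, Finset.sum_mul]
  exact Finset.sum_congr rfl fun j _ => by rw [Finset.mul_sum]

theorem outer_add_smul_left {m₁ m₂ m₃ : ℕ} (a a' : EuclideanSpace ℝ (Fin m₁))
    (b : EuclideanSpace ℝ (Fin m₂)) (c : EuclideanSpace ℝ (Fin m₃)) (x : ℝ) :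
    outer (a + x • a') b c = outer a b c + x • outer a' b c := by
  ext p; simp [outer]; ring

theorem outer_add_smul_middle {m₁ m₂ m₃ : ℕ} (a : EuclideanSpace ℝ (Fin m₁))
    (b b' : EuclideanSpace ℝ (Fin m₂)) (c : EuclideanSpace ℝ (Fin m₃)) (x : ℝ) :
    outer a (b + x • b') c = outer a b c + x • outer a b' c := by
  ext p; simp [outer]; ring

theorem smul_outer_sub_smul_outer {m₁ m₂ m₃ : ℕ} (a : EuclideanSpace ℝ (Fin m₁))
    (b : EuclideanSpace ℝ (Fin m₂)) (c c' : EuclideanSpace ℝ (Fin m₃)) (x y : ℝ) :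
    x • outer a b c - y • outer a b c' = outer a b (x • c - y • c') := by
  ext p; simp [outer]; ring

theorem addMap_add_smul {r m₁ m₂ m₃ : ℕ} (t w : TensorTuple r m₁ m₂ m₃) (s : ℝ) :
    addMap (t + s • w) = addMap t + s • addMap w := by
  simp [addMap, Finset.sum_add_distrib, Finset.smul_sum]

theorem condNumber_eq_top_of_notMem {r m₁ m₂ m₃ : ℕ} {t : TensorTuple r m₁ m₂ m₃}
    (ht : t ∉ segrePow r m₁ m₂ m₃) : condNumber t = ∞ := by
  simp only [condNumber, iInf_eq_top]
  exact fun U Ψ h => absurd (h.subset h.mem) ht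

/-- A line segment in `S ^ r` through `t` with direction `w` forces the condition number at `t` to
be at least `‖w‖ / ‖Φ_r w‖`, which is to be read as `∞` if `Φ_r w = 0`. -/
theorem le_condNumber_of_line {r m₁ m₂ m₃ : ℕ} {t w : TensorTuple r m₁ m₂ m₃} {C : ℝ}
    (hw : w ≠ 0) (hseg : ∀ᶠ s : ℝ in 𝓝 0, t + s • w ∈ segrePow r m₁ m₂ m₃)
    (hC : C * ‖addMap w‖ ≤ ‖w‖) : ENNReal.ofReal C ≤ condNumber t := by
  refine le_iInf fun U => le_iInf₂ fun Ψ h => le_iInf₂ fun ε hε => ?_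
  have hline : Tendsto (fun s : ℝ => t + s • w) (𝓝 0) (𝓝[segrePow r m₁ m₂ m₃] t) := by
    refine tendsto_nhdsWithin_iff.2 ⟨?_, hseg⟩
    have : Continuous fun s : ℝ => t + s • w := by fun_prop
    simpa using this.tendsto 0
  have hsmall : ∀ᶠ s : ℝ in 𝓝 0, ‖s • addMap w‖ < ε := by
    have : Continuous fun s : ℝ => ‖s • addMap w‖ := by fun_prop
    exact (this.tendsto 0).eventually (gt_mem_nhds (by simpa using hε))
  obtain ⟨s, ⟨hsU, hsε⟩, hs⟩ := ((((hline.eventually_mem h.nhds).and hsmall).filter_mono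
    (nhdsWithin_le_nhds (s := Set.Ioi (0 : ℝ)))).and self_mem_nhdsWithin).exists
  replace hs : 0 < s := hs
  replace hsU : t + s • w ∈ U := hsU
  have hA : Ψ (addMap t) = t := h.left_inv t h.mem
  -- `Φ_r` is injective on `U`, so it cannot be constant along the segment.
  have hne : addMap (t + s • w) ≠ addMap t := by
    intro he
    have h2 := h.left_inv _ hsU
    rw [he, hA] at h2
    exact smul_ne_zero hs.ne' hw (by simpa using h2.symm)
  have hΦ : 0 < ‖addMap w‖ := by
    rw [norm_pos_iff]
    intro h0
    exact hne (by rw [addMap_add_smul, h0, smul_zero, add_zero])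
  have hdiff : ‖addMap t - addMap (t + s • w)‖ = s * ‖addMap w‖ := by
    rw [addMap_add_smul, sub_add_cancel_left, norm_neg, norm_smul, Real.norm_of_nonneg hs.le]
  refine le_trans ?_ (le_iSup₂ (addMap (t + s • w)) ⟨⟨_, hsU, rfl⟩, hne, ?_⟩)
  · rw [hA, h.left_inv _ hsU, hdiff, sub_add_cancel_left, norm_neg, norm_smul,
      Real.norm_of_nonneg hs.le]
    refine ENNReal.ofReal_le_ofReal ?_
    rw [le_div_iff₀ (by positivity)]
    nlinarith
  · rwa [addMap_add_smul, sub_add_cancel_left, norm_neg]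

/-- Two summands whose third factors are close make the condition number large: the tensor
`a j ⊗ b i ⊗ c` is tangent to the Segre manifold both at the `i`-th summand (for
`c = c i / ‖c i‖`) and at the `j`-th summand (for `c = c j / ‖c j‖`), and these two tangent vectors
nearly cancel in the sum. -/
theorem le_condNumber_of_close {r m₁ m₂ m₃ : ℕ} (a : Fin r → EuclideanSpace ℝ (Fin m₁))
    (b : Fin r → EuclideanSpace ℝ (Fin m₂)) (c : Fin r → EuclideanSpace ℝ (Fin m₃)) {ρ : ℝ}
    (hρ : 0 < ρ) {i j : Fin r} (hij : i ≠ j) (h : Close ρ (c i) (c j)) :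
    ENNReal.ofReal (√2 / ρ) ≤ condNumber (cpdTuple a b c) := by
  by_cases ht : cpdTuple a b c ∈ segrePow r m₁ m₂ m₃
  swap
  · simp [condNumber_eq_top_of_notMem ht]
  have hci : 0 < ‖c i‖ := norm_pos_iff.2 h.ne_zero_left
  have hcj : 0 < ‖c j‖ := norm_pos_iff.2 h.symm.ne_zero_left
  have hpos : ∀ k, 0 < ‖a k‖ * ‖b k‖ * ‖c k‖ := fun k => by
    rw [← norm_outer]; exact norm_pos_iff.2 (ht k).1
  have hN : 0 < ‖a j‖ * ‖b i‖ := by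
    have h1 := (hpos i).ne'
    have h2 := (hpos j).ne'
    simp only [ne_eq, mul_eq_zero, not_or] at h1 h2
    have := norm_pos_iff.2 (norm_ne_zero_iff.1 h2.1.1)
    have := norm_pos_iff.2 (norm_ne_zero_iff.1 h1.1.2)
    positivity
  set w : TensorTuple r m₁ m₂ m₃ := WithLp.toLp 2
    (Pi.single i ((‖c i‖⁻¹) • outer (a j) (b i) (c i)) -
      Pi.single j ((‖c j‖⁻¹) • outer (a j) (b i) (c j))) with hwdef
  have hwi : w i = (‖c i‖⁻¹) • outer (a j) (b i) (c i) := by simp [hwdef, hij]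
  have hwj : w j = -((‖c j‖⁻¹) • outer (a j) (b i) (c j)) := by simp [hwdef, hij.symm]
  have hwk : ∀ k, k ≠ i → k ≠ j → w k = 0 := fun k hi hj => by simp [hwdef, hi, hj]
  have hni : ‖w i‖ = ‖a j‖ * ‖b i‖ := by
    rw [hwi, norm_smul, norm_outer, norm_inv, norm_norm]; field_simp
  have hnj : ‖w j‖ = ‖a j‖ * ‖b i‖ := by
    rw [hwj, norm_neg, norm_smul, norm_outer, norm_inv, norm_norm]; field_simp
  have hnw : ‖w‖ = √2 * (‖a j‖ * ‖b i‖) := by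
    rw [← sq_eq_sq₀ (norm_nonneg _) (by positivity), PiLp.norm_sq_eq_of_L2,
      Fintype.sum_eq_add i j hij fun k hk => by rw [hwk k hk.1 hk.2]; simp, hni, hnj,
      mul_pow √2, Real.sq_sqrt zero_le_two]
    ring
  refine le_condNumber_of_line (w := w) ?_ ?_ ?_
  · rw [← norm_pos_iff, hnw]; positivity
  · have hne : ∀ᶠ s : ℝ in 𝓝 0, ∀ k, (cpdTuple a b c + s • w) k ≠ 0 := by
      refine eventually_all.2 fun k => ?_
      have : Continuous fun s : ℝ => (cpdTuple a b c + s • w) k := by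
        simp only [PiLp.add_apply, PiLp.smul_apply]; fun_prop
      exact (this.tendsto 0).eventually_ne (by simpa using (ht k).1)
    -- The `i`-th summand moves in its first factor, the `j`-th one in its second factor.
    filter_upwards [hne] with s hs k
    refine ⟨hs k, ?_⟩
    rcases eq_or_ne k i with rfl | hki
    · exact ⟨a k + (s * ‖c k‖⁻¹) • a j, b k, c k, by
        rw [outer_add_smul_left, PiLp.add_apply, PiLp.smul_apply, hwi, smul_smul]; rfl⟩
    rcases eq_or_ne k j with rfl | hkj
    · exact ⟨a k, b k + (-(s * ‖c k‖⁻¹)) • b i, c k, by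
        rw [outer_add_smul_middle, PiLp.add_apply, PiLp.smul_apply, hwj, smul_neg, smul_smul,
          neg_smul]; rfl⟩
    · exact ⟨a k, b k, c k, by
        rw [PiLp.add_apply, PiLp.smul_apply, hwk k hki hkj, smul_zero, add_zero]; rfl⟩
  · have hadd : addMap w = outer (a j) (b i) ((‖c i‖⁻¹) • c i - (‖c j‖⁻¹) • c j) := by
      rw [addMap, Fintype.sum_eq_add i j hij fun k hk => hwk k hk.1 hk.2, hwi, hwj,
        ← sub_eq_add_neg, smul_outer_sub_smul_outer]
    rw [hadd, hnw, norm_outer, div_mul_eq_mul_div, div_le_iff₀ hρ]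
    rw [mul_assoc √2]
    exact mul_le_mul_of_nonneg_left
      (mul_le_mul_of_nonneg_left (h.norm_sub_le hρ.le) hN.le) (Real.sqrt_nonneg 2)

/-! ### The Gaussian measure of thin cones -/

section
variable {E : Type*} [NormedAddCommGroup E] [InnerProductSpace ℝ E] {τ : ℝ}

theorem measurableSet_close_prod [MeasurableSpace E] [BorelSpace E] [SecondCountableTopology E] :
    MeasurableSet {z : E × E | Close τ z.1 z.2} := by
  have h1 : MeasurableSet {z : E × E | 0 < inner ℝ z.1 z.2} :=
    measurableSet_lt (by fun_prop) (by fun_prop)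
  have h2 : MeasurableSet
      {z : E × E | ‖z.1‖ ^ 2 * ‖z.2‖ ^ 2 ≤ (1 + τ ^ 2) * inner ℝ z.1 z.2 ^ 2} :=
    measurableSet_le (by fun_prop) (by fun_prop)
  exact h1.inter h2

theorem measurableSet_close [MeasurableSpace E] [BorelSpace E] [SecondCountableTopology E] (x : E) :
    MeasurableSet {y : E | Close τ x y} :=
  measurableSet_close_prod.preimage (f := fun y => (x, y)) (by fun_prop)

/-- By rotation invariance, the Gaussian measure of the cone of all vectors close to `x ≠ 0` does
not depend on `x`. -/
theorem stdGaussian_close_eq [FiniteDimensional ℝ E] [MeasurableSpace E] [BorelSpace E] {x e : E}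
    (hx : x ≠ 0) (he : ‖e‖ = 1) :
    stdGaussian E {y | Close τ x y} = stdGaussian E {y | Close τ e y} := by
  have hx0 : 0 < ‖x‖ := norm_pos_iff.2 hx
  set f : E ≃ₗᵢ[ℝ] E := Submodule.reflection (ℝ ∙ (x - ‖x‖ • e))ᗮ
  -- `f` is the reflection that carries `x` to the positive multiple of `e` of the same norm.
  have hf : f x = ‖x‖ • e := Submodule.reflection_sub (by rw [norm_smul, he, norm_norm, mul_one])
  conv_rhs => rw [← stdGaussian_map f]
  rw [Measure.map_apply (by fun_prop) (measurableSet_close e)]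
  congr 1
  ext y
  rw [Set.mem_preimage, Set.mem_ofPred_eq, Set.mem_ofPred_eq, ← close_map_iff f, hf,
    close_smul_left_iff hx0]

end

/-- A product of Gaussian measures has the product density. -/
theorem pi_gaussianReal_eq_withDensity (ι : Type*) [Fintype ι] :
    (Measure.pi fun _ : ι => gaussianReal 0 1) =
      volume.withDensity fun z : ι → ℝ => ENNReal.ofReal (∏ i, gaussianPDFReal 0 1 (z i)) := by
  refine Measure.pi_eq fun s hs => ?_
  rw [withDensity_apply _ (MeasurableSet.univ_pi hs), volume_pi, Measure.restrict_pi_pi,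
    ← ofReal_integral_eq_lintegral_ofReal
      (Integrable.fintype_prod fun i => (integrable_gaussianPDFReal 0 1).restrict)
      (ae_of_all _ fun z => Finset.prod_nonneg fun i _ => gaussianPDFReal_nonneg 0 1 _),
    integral_fintype_prod_eq_prod (f := fun _ x => gaussianPDFReal 0 1 x),
    ENNReal.ofReal_prod_of_nonneg fun i _ =>
      integral_nonneg fun x => gaussianPDFReal_nonneg 0 1 x]
  exact Finset.prod_congr rfl fun i _ => (gaussianReal_apply_eq_integral 0 one_ne_zero _).symm

theorem prod_gaussianPDFReal {ι : Type*} [Fintype ι] (z : ι → ℝ) :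
    ∏ i, gaussianPDFReal 0 1 (z i) =
      (√(2 * Real.pi))⁻¹ ^ Fintype.card ι * Real.exp (-(∑ i, z i ^ 2) / 2) := by
  simp only [gaussianPDFReal_def, sub_zero, NNReal.coe_one, mul_one, Finset.prod_mul_distrib,
    Finset.prod_const, Finset.card_univ, ← Real.exp_sum, ← Finset.sum_div, Finset.sum_neg_distrib]

/-- The Lebesgue measure of the Euclidean unit ball in dimension `m`. -/
noncomputable def unitBallVolume (m : ℕ) : ℝ := √Real.pi ^ m / Real.Gamma (m / 2 + 1)

theorem unitBallVolume_pos (m : ℕ) : 0 < unitBallVolume m :=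
  div_pos (by positivity) (Real.Gamma_pos_of_pos (by positivity))

theorem volume_sum_sq_le {m : ℕ} (hm : 0 < m) {s : ℝ} (hs : 0 ≤ s) :
    volume {z : Fin m → ℝ | ∑ i, z i ^ 2 ≤ s ^ 2} = ENNReal.ofReal (s ^ m * unitBallVolume m) := by
  have : Nonempty (Fin m) := ⟨⟨0, hm⟩⟩
  have h := EuclideanSpace.volume_closedBall (Fin m) 0 s
  rw [← (PiLp.volume_preserving_toLp (Fin m)).measure_preimage
    Metric.isClosed_closedBall.measurableSet.nullMeasurableSet] at h
  rw [ENNReal.ofReal_mul (by positivity), ENNReal.ofReal_pow hs, unitBallVolume]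
  simp only [Fintype.card_fin] at h
  rw [← h]
  congr 1
  ext z
  rw [Set.mem_preimage, mem_closedBall_zero_iff, Set.mem_ofPred_eq,
    ← sq_le_sq₀ (norm_nonneg _) hs, EuclideanSpace.real_norm_sq_eq]

theorem pi_gaussianReal_ball_le {m : ℕ} (hm : 0 < m) {s : ℝ} (hs : 0 ≤ s) :
    (Measure.pi fun _ : Fin m => gaussianReal 0 1) {z | ∑ i, z i ^ 2 ≤ s ^ 2} ≤
      ENNReal.ofReal ((√(2 * Real.pi))⁻¹ ^ m * (s ^ m * unitBallVolume m)) := by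
  have hS : MeasurableSet {z : Fin m → ℝ | ∑ i, z i ^ 2 ≤ s ^ 2} :=
    measurableSet_le (by fun_prop) (by fun_prop)
  rw [pi_gaussianReal_eq_withDensity, withDensity_apply _ hS, ENNReal.ofReal_mul (by positivity),
    ← volume_sum_sq_le hm hs, ← setLIntegral_const]
  refine setLIntegral_mono (by fun_prop) fun z hz => ENNReal.ofReal_le_ofReal ?_
  rw [prod_gaussianPDFReal, Fintype.card_fin]
  refine mul_le_of_le_one_right (by positivity) (Real.exp_le_one_iff.2 ?_)
  have := Finset.sum_nonneg fun i (_ : i ∈ Finset.univ) => sq_nonneg (z i)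
  linarith

theorem le_pi_gaussianReal_ball {m : ℕ} (hm : 0 < m) {s : ℝ} (hs : 0 ≤ s) :
    ENNReal.ofReal ((√(2 * Real.pi))⁻¹ ^ m * Real.exp (-s ^ 2 / 2) * (s ^ m * unitBallVolume m)) ≤
    (Measure.pi fun _ : Fin m => gaussianReal 0 1) {z | ∑ i, z i ^ 2 ≤ s ^ 2} := by
  have hS : MeasurableSet {z : Fin m → ℝ | ∑ i, z i ^ 2 ≤ s ^ 2} :=
    measurableSet_le (by fun_prop) (by fun_prop)
  rw [pi_gaussianReal_eq_withDensity, withDensity_apply _ hS, ENNReal.ofReal_mul (by positivity),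
    ← volume_sum_sq_le hm hs, ← setLIntegral_const]
  refine setLIntegral_mono' hS fun z hz => ENNReal.ofReal_le_ofReal ?_
  rw [prod_gaussianPDFReal, Fintype.card_fin]
  have : ∑ i, z i ^ 2 ≤ s ^ 2 := hz
  gcongr

theorem lintegral_pow_mul_exp_neg_mul_sq (m : ℕ) {b D : ℝ} (hb : 0 < b) (hD : 0 ≤ D) :
    ∫⁻ x in Set.Ioi (0 : ℝ), ENNReal.ofReal (D * (x ^ m * Real.exp (-b * x ^ 2))) =
      ENNReal.ofReal
        (D * (b ^ (-((m : ℝ) + 1) / 2) * (1 / 2) * Real.Gamma (((m : ℝ) + 1) / 2))) := by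
  have hm : (-1 : ℝ) < m := by linarith [Nat.cast_nonneg (α := ℝ) m]
  have h := integral_rpow_mul_exp_neg_mul_rpow (p := 2) two_pos hm hb
  have hi := integrableOn_rpow_mul_exp_neg_mul_sq hb hm
  simp only [Real.rpow_natCast, Real.rpow_two] at h hi
  rw [← h, ← integral_const_mul, ofReal_integral_eq_lintegral_ofReal (hi.const_mul D)]
  filter_upwards [ae_restrict_mem measurableSet_Ioi] with x hx
  have : 0 < x := hx
  positivity

/-- The Gaussian measure of the cone of half angle `arctan τ` in `ℝ^(m+1)`. -/
noncomputable def coneProb (m : ℕ) (τ : ℝ) : ℝ :=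
  (stdGaussian (EuclideanSpace ℝ (Fin (m + 1)))).real
    {y | Close τ (EuclideanSpace.single 0 1) y}

/-- The cone around the first basis vector is cut, at height `x > 0`, in a ball of
radius `τ * x`. -/
theorem stdGaussian_cone_eq_lintegral (m : ℕ) {τ : ℝ} :
    stdGaussian (EuclideanSpace ℝ (Fin (m + 1))) {y | Close τ (EuclideanSpace.single 0 1) y} =
      ∫⁻ x in Set.Ioi (0 : ℝ), gaussianPDF 0 1 x *
        (Measure.pi fun _ : Fin m => gaussianReal 0 1) {z | ∑ i, z i ^ 2 ≤ (τ * x) ^ 2} := by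
  set S : Set (ℝ × (Fin m → ℝ)) := {q | 0 < q.1 ∧ ∑ i, q.2 i ^ 2 ≤ (τ * q.1) ^ 2} with hSdef
  have hS₁ : MeasurableSet {q : ℝ × (Fin m → ℝ) | 0 < q.1} :=
    measurableSet_lt (by fun_prop) (by fun_prop)
  have hS₂ : MeasurableSet {q : ℝ × (Fin m → ℝ) | ∑ i, q.2 i ^ 2 ≤ (τ * q.1) ^ 2} :=
    measurableSet_le (by fun_prop) (by fun_prop)
  have hS : MeasurableSet S := hS₁.inter hS₂
  have hmp := measurePreserving_piFinSuccAbove (fun _ : Fin (m + 1) => gaussianReal 0 1) 0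
  have hpre : WithLp.toLp 2 ⁻¹' {y | Close τ (EuclideanSpace.single (0 : Fin (m + 1)) (1 : ℝ)) y} =
      MeasurableEquiv.piFinSuccAbove (fun _ : Fin (m + 1) => ℝ) 0 ⁻¹' S := by
    ext y
    have h1 : inner ℝ (EuclideanSpace.single (0 : Fin (m + 1)) (1 : ℝ)) (WithLp.toLp 2 y) =
        y 0 := by
      simp [EuclideanSpace.inner_single_left]
    have h2 : ‖EuclideanSpace.single (0 : Fin (m + 1)) (1 : ℝ)‖ = 1 := by simp
    rw [Set.mem_preimage, Set.mem_ofPred_eq, Close, h1, h2, EuclideanSpace.real_norm_sq_eq,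
      Fin.sum_univ_succ]
    refine and_congr Iff.rfl ?_
    change _ ↔ ∑ i : Fin m, y i.succ ^ 2 ≤ (τ * y 0) ^ 2
    simp only [one_pow, one_mul]
    constructor <;> intro h <;> nlinarith
  have hdens : ∀ f : ℝ → ℝ≥0∞, Measurable f →
      ∫⁻ x, f x ∂gaussianReal 0 1 = ∫⁻ x, gaussianPDF 0 1 x * f x := fun f hf => by
    rw [gaussianReal_of_var_ne_zero 0 one_ne_zero]
    exact lintegral_withDensity_eq_lintegral_mul _ (measurable_gaussianPDF 0 1) hf
  rw [← map_pi_eq_stdGaussian, Measure.map_apply (by fun_prop) (measurableSet_close _), hpre,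
    hmp.measure_preimage hS.nullMeasurableSet, Measure.prod_apply hS,
    hdens _ (measurable_measure_prodMk_left hS), ← lintegral_indicator measurableSet_Ioi]
  refine lintegral_congr fun x => ?_
  by_cases hx : 0 < x
  · rw [Set.indicator_of_mem (by exact hx)]
    congr 2
    ext z
    simp [hSdef, hx]
  · rw [Set.indicator_of_notMem (by exact hx)]
    have : Prod.mk x ⁻¹' S = ∅ := by ext z; simp [hSdef, hx]
    rw [this, measure_empty, mul_zero]

/-- The constant with `coneProb m τ ∼ coneConst m * 2 ^ ((m + 1) / 2) * τ ^ m` as `τ → 0`; it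
collects the factors that do not come from the width of the radial Gaussian integral. -/
noncomputable def coneConst (m : ℕ) : ℝ :=
  (√(2 * Real.pi))⁻¹ ^ (m + 1) * unitBallVolume m * (1 / 2 * Real.Gamma (((m : ℝ) + 1) / 2))

theorem coneConst_pos (m : ℕ) : 0 < coneConst m := by
  have := unitBallVolume_pos m
  have : 0 < Real.Gamma (((m : ℝ) + 1) / 2) := Real.Gamma_pos_of_pos (by positivity)
  rw [coneConst]
  positivity

theorem coneProb_le {m : ℕ} (hm : 0 < m) {τ : ℝ} (hτ : 0 ≤ τ) :
    coneProb m τ ≤ coneConst m * (1 / 2 : ℝ) ^ (-((m : ℝ) + 1) / 2) * τ ^ m := by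
  have hV := unitBallVolume_pos m
  have hC := coneConst_pos m
  refine ENNReal.toReal_le_of_le_ofReal (by positivity) ?_
  rw [stdGaussian_cone_eq_lintegral]
  calc _ ≤ ∫⁻ x in Set.Ioi (0 : ℝ), ENNReal.ofReal (((√(2 * Real.pi))⁻¹ ^ (m + 1) *
        unitBallVolume m * τ ^ m) * (x ^ m * Real.exp (-(1 / 2) * x ^ 2))) := by
        refine setLIntegral_mono' measurableSet_Ioi fun x hx => ?_
        have hx0 : 0 < x := hx
        refine (mul_le_mul_right (pi_gaussianReal_ball_le hm (by positivity)) _).trans_eq ?_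
        rw [gaussianPDF, ← ENNReal.ofReal_mul (gaussianPDFReal_nonneg 0 1 x), gaussianPDFReal]
        congr 1
        simp only [NNReal.coe_one, mul_one, sub_zero]
        rw [show -x ^ 2 / 2 = -(1 / 2) * x ^ 2 by ring]
        ring
    _ = _ := by
        rw [lintegral_pow_mul_exp_neg_mul_sq m (by norm_num) (by positivity), coneConst]
        congr 1
        ring

theorem le_coneProb {m : ℕ} (hm : 0 < m) {τ : ℝ} (hτ : 0 ≤ τ) :
    coneConst m * ((1 + τ ^ 2) / 2) ^ (-((m : ℝ) + 1) / 2) * τ ^ m ≤ coneProb m τ := by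
  have hV := unitBallVolume_pos m
  refine (ENNReal.ofReal_le_iff_le_toReal (measure_ne_top _ _)).1 ?_
  rw [stdGaussian_cone_eq_lintegral]
  calc _ = ∫⁻ x in Set.Ioi (0 : ℝ), ENNReal.ofReal (((√(2 * Real.pi))⁻¹ ^ (m + 1) *
        unitBallVolume m * τ ^ m) * (x ^ m * Real.exp (-((1 + τ ^ 2) / 2) * x ^ 2))) := by
        rw [lintegral_pow_mul_exp_neg_mul_sq m (by positivity) (by positivity), coneConst]
        congr 1
        ring
    _ ≤ _ := by
        refine setLIntegral_mono' measurableSet_Ioi fun x hx => ?_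
        have hx0 : 0 < x := hx
        refine Eq.trans_le ?_ (mul_le_mul_right (le_pi_gaussianReal_ball hm (by positivity)) _)
        rw [gaussianPDF, ← ENNReal.ofReal_mul (gaussianPDFReal_nonneg 0 1 x), gaussianPDFReal]
        congr 1
        simp only [NNReal.coe_one, mul_one, sub_zero]
        rw [show -((1 + τ ^ 2) / 2) * x ^ 2 = -x ^ 2 / 2 + -(τ * x) ^ 2 / 2 by ring, Real.exp_add]
        ring

/-- The asymptotics of the measure of thin cones. -/
theorem tendsto_coneProb_div_pow {m : ℕ} (hm : 0 < m) :
    Tendsto (fun τ => coneProb m τ / τ ^ m) (𝓝[>] 0)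
      (𝓝 (coneConst m * (1 / 2 : ℝ) ^ (-((m : ℝ) + 1) / 2))) := by
  have hlow : Tendsto (fun τ : ℝ => coneConst m * ((1 + τ ^ 2) / 2) ^ (-((m : ℝ) + 1) / 2))
      (𝓝[>] 0) (𝓝 (coneConst m * (1 / 2 : ℝ) ^ (-((m : ℝ) + 1) / 2))) := by
    have hc : ContinuousAt
        (fun τ : ℝ => coneConst m * ((1 + τ ^ 2) / 2) ^ (-((m : ℝ) + 1) / 2)) 0 :=
      continuousAt_const.mul (ContinuousAt.rpow_const (by fun_prop) (Or.inl (by norm_num)))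
    simpa using hc.tendsto.mono_left nhdsWithin_le_nhds
  refine tendsto_of_tendsto_of_tendsto_of_le_of_le' hlow tendsto_const_nhds ?_ ?_
  · filter_upwards [self_mem_nhdsWithin] with τ hτ
    have hτ0 : 0 < τ := hτ
    exact (le_div_iff₀ (by positivity)).2 (le_coneProb hm hτ0.le)
  · filter_upwards [self_mem_nhdsWithin] with τ hτ
    have hτ0 : 0 < τ := hτ
    exact (div_le_iff₀ (by positivity)).2 (coneProb_le hm hτ0.le)

/-- `constK` is the limit of the expected number `r² / 2 * coneProb m ρ` of close pairs among `r`
points if `ρ ^ m = √2 ^ m / r²`. -/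
theorem constK_eq {m : ℕ} :
    constK (m + 1) =
      coneConst m * (1 / 2 : ℝ) ^ (-((m : ℝ) + 1) / 2) * (√2 ^ m / 2) := by
  have hG : 0 < Real.Gamma ((m : ℝ) / 2 + 1) := Real.Gamma_pos_of_pos (by positivity)
  have hπ : 0 < √Real.pi := Real.sqrt_pos.2 Real.pi_pos
  have h2 : (2 : ℝ) ^ (((m : ℝ) + 1 - 5) / 2) = √2 ^ m / 4 := by
    rw [show ((m : ℝ) + 1 - 5) / 2 = 1 / 2 * m - 2 by ring, Real.rpow_sub two_pos,
      Real.rpow_mul zero_le_two, ← Real.sqrt_eq_rpow, Real.rpow_natCast]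
    norm_num
  have h3 : (1 / 2 : ℝ) ^ (-((m : ℝ) + 1) / 2) = √2 ^ (m + 1) := by
    rw [one_div, Real.inv_rpow zero_le_two, ← Real.rpow_neg zero_le_two,
      show -(-((m : ℝ) + 1) / 2) = 1 / 2 * ((m + 1 : ℕ) : ℝ) by push_cast; ring,
      Real.rpow_mul zero_le_two, ← Real.sqrt_eq_rpow, Real.rpow_natCast]
  rw [constK, coneConst, unitBallVolume, h3]
  push_cast
  rw [h2, Real.sqrt_mul zero_le_two, show ((m : ℝ) + 1 + 1) / 2 = m / 2 + 1 by ring, inv_pow]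
  field_simp
  ring

/-! ### Configurations of independent points without a related pair -/

/-- Second Bonferroni inequality, restricted to a set `A` and with a uniform bound `q` on the
measures of the pairwise intersections. -/
theorem measureReal_diff_biUnion_le {α ι : Type*} [MeasurableSpace α] {μ : Measure α}
    [IsFiniteMeasure μ] {A : Set α} {F : ι → Set α} (hF : ∀ i, MeasurableSet (F i)) {q : ℝ}
    (hq0 : 0 ≤ q) (hq : ∀ i j, i ≠ j → μ.real (F i ∩ F j) ≤ q) (s : Finset ι) :
    μ.real (A \ ⋃ i ∈ s, F i) ≤
      μ.real A - ∑ i ∈ s, μ.real (A ∩ F i) + (s.card : ℝ) ^ 2 * q := by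
  classical
  induction s using Finset.induction_on with
  | empty => simp
  | insert a s ha ih =>
    have hU : MeasurableSet (⋃ i ∈ s, F i) := s.measurableSet_biUnion fun i _ => hF i
    have h1 : A \ ⋃ i ∈ insert a s, F i = (A \ ⋃ i ∈ s, F i) \ F a := by
      rw [Finset.set_biUnion_insert, Set.union_comm, Set.sdiff_sdiff]
    have h2 := measureReal_sdiff_add_inter (μ := μ) (s := A \ ⋃ i ∈ s, F i) (hF a)
    have h3 : A ∩ F a ⊆ ((A \ ⋃ i ∈ s, F i) ∩ F a) ∪ ⋃ i ∈ s, F i ∩ F a := by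
      rintro x ⟨hx, hxa⟩
      by_cases hxU : x ∈ ⋃ i ∈ s, F i
      · right
        simp only [Set.mem_iUnion] at hxU ⊢
        obtain ⟨i, hi, hxi⟩ := hxU
        exact ⟨i, hi, hxi, hxa⟩
      · exact Or.inl ⟨⟨hx, hxU⟩, hxa⟩
    have h4 : μ.real (⋃ i ∈ s, F i ∩ F a) ≤ s.card * q := by
      refine (measureReal_biUnion_finset_le s _).trans ?_
      rw [← nsmul_eq_mul]
      exact Finset.sum_le_card_nsmul _ _ _ fun i hi => hq i a (ne_of_mem_of_not_mem hi ha)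
    have h5 := (measureReal_mono (μ := μ) h3).trans (measureReal_union_le _ _)
    have h6 : (s.card : ℝ) ^ 2 * q + s.card * q ≤ ((insert a s).card : ℝ) ^ 2 * q := by
      rw [Finset.card_insert_of_notMem ha]
      push_cast
      nlinarith [Nat.cast_nonneg (α := ℝ) s.card]
    rw [h1, Finset.sum_insert ha]
    linarith

section

variable {E : Type*} [MeasurableSpace E] {γ : Measure E} [IsProbabilityMeasure γ]

/-- The configurations of `k` points no two of which are related by `R`. -/
def pairFree {E : Type*} (R : E → E → Prop) (k : ℕ) : Set (Fin k → E) :=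
  {x | ∀ i j, i ≠ j → ¬ R (x i) (x j)}

variable {R : E → E → Prop}

theorem measurableSet_pairFree (hR : MeasurableSet {z : E × E | R z.1 z.2}) (k : ℕ) :
    MeasurableSet (pairFree R k) := by
  simp only [pairFree, Set.ofPred_forall]
  refine MeasurableSet.iInter fun i => MeasurableSet.iInter fun j =>
    MeasurableSet.iInter fun _ => ?_
  exact (hR.preimage (f := fun x : Fin k → E => (x i, x j)) (by fun_prop)).compl

/-- Adding one independent point to `k` points, if a random point is related to almost every fixed
point with the same probability `p`. The event that the new point is related to the `i`-th one has
probability `p`, also conditionally on the first `k` points being pair free, and any two of these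
events are independent. -/
theorem measureReal_pairFree_succ_le (hR : MeasurableSet {z : E × E | R z.1 z.2})
    (hsymm : ∀ x y, R x y → R y x) {p : ℝ} (hp : ∀ᵐ x ∂γ, γ.real {y | R x y} = p) (k : ℕ) :
    (Measure.pi fun _ : Fin (k + 1) => γ).real (pairFree R (k + 1)) ≤
      (1 - k * p) * (Measure.pi fun _ : Fin k => γ).real (pairFree R k) + (k : ℝ) ^ 2 * p ^ 2 := by
  set μ := Measure.pi fun _ : Fin k => γ
  have hE := measurableSet_pairFree hR k
  have hp' : ∀ᵐ x ∂γ, γ {y | R x y} = ENNReal.ofReal p := by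
    filter_upwards [hp] with x hx
    rw [← hx, ofReal_measureReal]
  have hp0 : 0 ≤ p := by
    obtain ⟨x, hx⟩ := hp.exists
    rw [← hx]; exact measureReal_nonneg
  have hRx : ∀ x, MeasurableSet {y | R x y} := fun x =>
    hR.preimage (f := fun y => (x, y)) (by fun_prop)
  have hRs : ∀ x, {y | R y x} = {y | R x y} := fun x => Set.ext fun y => ⟨hsymm _ _, hsymm _ _⟩
  let A : Set (E × (Fin k → E)) := {z | z.2 ∈ pairFree R k}
  let F : Fin k → Set (E × (Fin k → E)) := fun i => {z | R z.1 (z.2 i)}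
  have hA : MeasurableSet A := hE.preimage measurable_snd
  have hF : ∀ i, MeasurableSet (F i) := fun i =>
    hR.preimage (f := fun z : E × (Fin k → E) => (z.1, z.2 i)) (by fun_prop)
  -- Integrate over the new point first.
  have hAF : ∀ i, (γ.prod μ).real (A ∩ F i) = p * μ.real (pairFree R k) := by
    intro i
    have h1 : ∀ᵐ z ∂μ, γ ((fun y => (y, z)) ⁻¹' (A ∩ F i)) =
        (pairFree R k).indicator (fun _ => ENNReal.ofReal p) z := by
      have := (measurePreserving_eval (fun _ : Fin k => γ) i).quasiMeasurePreserving.ae hp'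
      filter_upwards [this] with z hz
      by_cases hzE : z ∈ pairFree R k
      · rw [Set.indicator_of_mem hzE, ← hz, ← hRs]
        congr 1
        ext y
        exact ⟨fun h => h.2, fun h => ⟨hzE, h⟩⟩
      · rw [Set.indicator_of_notMem hzE, ← measure_empty (μ := γ)]
        congr 1
        ext y
        exact ⟨fun h => hzE h.1, fun h => h.elim⟩
    rw [measureReal_def, Measure.prod_apply_symm (hA.inter (hF i)), lintegral_congr_ae h1,
      lintegral_indicator_const hE, ENNReal.toReal_mul, ENNReal.toReal_ofReal hp0,
      measureReal_def]
  -- Integrate over the old points first: for a fixed new point, they are independent.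
  have hFF : ∀ i j, i ≠ j → (γ.prod μ).real (F i ∩ F j) ≤ p ^ 2 := by
    intro i j hij
    have h1 : ∀ᵐ x ∂γ, μ (Prod.mk x ⁻¹' (F i ∩ F j)) = ENNReal.ofReal p ^ 2 := by
      filter_upwards [hp'] with x hx
      have hind := (iIndepFun_pi (μ := fun _ : Fin k => γ) (X := fun _ => id)
        (fun _ => aemeasurable_id)).indepFun hij
      have := hind.measure_inter_preimage_eq_mul _ _ (hRx x) (hRx x)
      have hev : ∀ l, μ ((fun ω : Fin k → E => id (ω l)) ⁻¹' {y | R x y}) = ENNReal.ofReal p := by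
        intro l
        rw [← hx]
        exact (measurePreserving_eval (fun _ : Fin k => γ) l).measure_preimage
          (hRx x).nullMeasurableSet
      rw [hev, hev, ← sq] at this
      exact this
    rw [measureReal_def, Measure.prod_apply ((hF i).inter (hF j)), lintegral_congr_ae h1]
    simp [ENNReal.toReal_ofReal hp0]
  have hmp := measurePreserving_piFinSuccAbove (fun _ : Fin (k + 1) => γ) 0
  have hpre : pairFree R (k + 1) =
      MeasurableEquiv.piFinSuccAbove (fun _ : Fin (k + 1) => E) 0 ⁻¹'
        (A \ ⋃ i ∈ Finset.univ, F i) := by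
    ext x
    change (∀ i j : Fin (k + 1), i ≠ j → ¬ R (x i) (x j)) ↔
      (∀ i j : Fin k, i ≠ j → ¬ R (x i.succ) (x j.succ)) ∧
        ¬ (x 0, fun i : Fin k => x i.succ) ∈ ⋃ i ∈ Finset.univ, F i
    have hU : (x 0, fun i : Fin k => x i.succ) ∈ ⋃ i ∈ Finset.univ, F i ↔
        ∃ i : Fin k, R (x 0) (x i.succ) := by simp [F]
    rw [hU]
    constructor
    · exact fun h => ⟨fun i j hij => h _ _ ((Fin.succ_injective k).ne hij),
        fun ⟨i, hi⟩ => h 0 i.succ (Fin.succ_ne_zero i).symm hi⟩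
    · rintro ⟨h1, h2⟩ i j hij
      cases i using Fin.cases with
      | zero =>
        cases j using Fin.cases with
        | zero => exact absurd rfl hij
        | succ j => exact fun h => h2 ⟨j, h⟩
      | succ i =>
        cases j using Fin.cases with
        | zero => exact fun h => h2 ⟨i, hsymm _ _ h⟩
        | succ j => exact h1 i j fun h => hij (congrArg _ h)
  have hmeas : MeasurableSet (A \ ⋃ i ∈ (Finset.univ : Finset (Fin k)), F i) :=
    hA.diff (Finset.measurableSet_biUnion _ fun i _ => hF i)
  rw [hpre, measureReal_def, hmp.measure_preimage hmeas.nullMeasurableSet, ← measureReal_def]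
  refine (measureReal_diff_biUnion_le hF (sq_nonneg p) hFF Finset.univ).trans_eq ?_
  have hAm : (γ.prod μ).real A = μ.real (pairFree R k) := by
    have : A = Set.univ ×ˢ pairFree R k := by ext; simp [A]
    rw [this, measureReal_prod_prod]; simp
  simp only [hAF, hAm, Finset.sum_const, Finset.card_univ, Fintype.card_fin, nsmul_eq_mul]
  ring

/-- Iteration of `measureReal_pairFree_succ_le`, with `1 - k * p ≤ exp (-(k * p))`. If `k² p` stays
bounded, the bound is the Poisson probability of no pair up to an error of order `1 / k`. -/
theorem measureReal_pairFree_le (hR : MeasurableSet {z : E × E | R z.1 z.2})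
    (hsymm : ∀ x y, R x y → R y x) {p : ℝ} (hp : ∀ᵐ x ∂γ, γ.real {y | R x y} = p) (k : ℕ) :
    (Measure.pi fun _ : Fin k => γ).real (pairFree R k) ≤
      Real.exp (-(k * (k - 1) / 2 * p)) + (k : ℝ) ^ 3 * p ^ 2 := by
  have hp0 : 0 ≤ p := by
    obtain ⟨x, hx⟩ := hp.exists
    rw [← hx]; exact measureReal_nonneg
  induction k with
  | zero => simp
  | succ k ih =>
    refine (measureReal_pairFree_succ_le hR hsymm hp k).trans ?_
    have h1 : 1 - k * p ≤ Real.exp (-(k * p)) := by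
      linarith [Real.add_one_le_exp (-(k * p))]
    have h2 : Real.exp (-(k * p)) ≤ 1 := Real.exp_le_one_iff.2 (by simp; positivity)
    calc _ ≤ Real.exp (-(k * p)) * (Real.exp (-(k * (k - 1) / 2 * p)) + (k : ℝ) ^ 3 * p ^ 2) +
          (k : ℝ) ^ 2 * p ^ 2 := by
            gcongr
      _ ≤ Real.exp (-(k * p)) * Real.exp (-(k * (k - 1) / 2 * p)) + 1 * ((k : ℝ) ^ 3 * p ^ 2) +
          (k : ℝ) ^ 2 * p ^ 2 := by
            rw [mul_add]; gcongr
      _ ≤ _ := by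
            rw [← Real.exp_add]
            have : -(k * p) + -(k * (k - 1) / 2 * p) =
              -(((k + 1 : ℕ) : ℝ) * ((k + 1 : ℕ) - 1) / 2 * p) := by push_cast; ring
            rw [this]
            have : (k : ℝ) ^ 3 + k ^ 2 ≤ ((k + 1 : ℕ) : ℝ) ^ 3 := by
              push_cast; nlinarith [Nat.cast_nonneg (α := ℝ) k, sq_nonneg (k : ℝ)]
            nlinarith [sq_nonneg p]
end

/-! ### The probability of a large condition number -/

/-- The radius `ρ` for which the bound `√2 / ρ` of `le_condNumber_of_close` is `α r ^ (2 / m)`. -/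
noncomputable def closeRadius (m r : ℕ) (α : ℝ) : ℝ := √2 / (α * (r : ℝ) ^ (2 / (m : ℝ)))

/-- The complement of the bound in `measureReal_pairFree_le`, for `r` standard Gaussian vectors in
`ℝ^(m+1)` and the relation `Close (closeRadius m r α)`. -/
noncomputable def tailBound (m r : ℕ) (α : ℝ) : ℝ :=
  1 - (Real.exp (-(r * (r - 1) / 2 * coneProb m (closeRadius m r α))) +
    (r : ℝ) ^ 3 * coneProb m (closeRadius m r α) ^ 2)

theorem ae_stdGaussian_close (m : ℕ) (τ : ℝ) :
    ∀ᵐ x ∂stdGaussian (EuclideanSpace ℝ (Fin (m + 1))),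
      (stdGaussian (EuclideanSpace ℝ (Fin (m + 1)))).real {y | Close τ x y} = coneProb m τ := by
  have h0 : ∀ᵐ z ∂Measure.pi fun _ : Fin (m + 1) => gaussianReal 0 1, z 0 ≠ 0 :=
    have := nullSingletonClass_gaussianReal (μ := 0) (v := 1) one_ne_zero
    Measure.ae_eval_ne _ 0 0
  have hne : ∀ᵐ x ∂stdGaussian (EuclideanSpace ℝ (Fin (m + 1))), x ≠ 0 := by
    rw [← map_pi_eq_stdGaussian]
    refine (ae_map_iff (p := fun x => x ≠ 0) (by fun_prop) (measurableSet_singleton 0).compl).2 ?_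
    filter_upwards [h0] with z hz h
    exact hz (by simpa using congrArg (fun x : EuclideanSpace ℝ (Fin (m + 1)) => x 0) h)
  filter_upwards [hne] with x hx
  rw [coneProb, measureReal_def, measureReal_def,
    stdGaussian_close_eq (e := EuclideanSpace.single 0 1) hx (by simp)]

theorem tailBound_le (m : ℕ) {α : ℝ} (hα : 0 < α) {r m₁ m₂ : ℕ}
    (a : Fin r → EuclideanSpace ℝ (Fin m₁)) (b : Fin r → EuclideanSpace ℝ (Fin m₂))
    {Ω : Type u} [MeasurableSpace Ω] (P : Measure Ω) [IsProbabilityMeasure P]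
    (c : Fin r → Ω → EuclideanSpace ℝ (Fin (m + 1))) (hc : iIndepFun c P)
    (hlaw : ∀ i, HasLaw (c i) (stdGaussian (EuclideanSpace ℝ (Fin (m + 1)))) P) :
    tailBound m r α ≤ P.real {ω | ENNReal.ofReal (α * (r : ℝ) ^ (2 / (m : ℝ))) ≤
      condNumber (cpdTuple a b fun i => c i ω)} := by
  rcases Nat.eq_zero_or_pos r with rfl | hr
  · -- Here `closeRadius` may be a junk value, but `tailBound` is `1 - (exp 0 + 0) = 0`.
    simp [tailBound]
  have hρ : 0 < closeRadius m r α := by rw [closeRadius]; positivity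
  have hκ : √2 / closeRadius m r α = α * (r : ℝ) ^ (2 / (m : ℝ)) := by
    rw [closeRadius, div_div_cancel₀ (by positivity)]
  set R : EuclideanSpace ℝ (Fin (m + 1)) → EuclideanSpace ℝ (Fin (m + 1)) → Prop :=
    Close (closeRadius m r α)
  have hR : MeasurableSet {z : EuclideanSpace ℝ (Fin (m + 1)) × EuclideanSpace ℝ (Fin (m + 1)) |
    R z.1 z.2} := measurableSet_close_prod
  have hmap : P.map (fun ω i => c i ω) =
      Measure.pi fun _ : Fin r => stdGaussian (EuclideanSpace ℝ (Fin (m + 1))) := by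
    rw [(iIndepFun_iff_map_fun_eq_pi_map fun i => (hlaw i).aemeasurable).1 hc]
    exact congrArg _ (funext fun i => (hlaw i).map_eq)
  have hsub : (fun ω i => c i ω) ⁻¹' (pairFree R r)ᶜ ⊆
      {ω | ENNReal.ofReal (α * (r : ℝ) ^ (2 / (m : ℝ))) ≤
        condNumber (cpdTuple a b fun i => c i ω)} := by
    intro ω hω
    simp only [pairFree, Set.mem_preimage, Set.mem_compl_iff, Set.mem_ofPred_eq, not_forall,
      not_not] at hω
    obtain ⟨i, j, hij, h⟩ := hω
    rw [Set.mem_ofPred_eq, ← hκ]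
    exact le_condNumber_of_close a b _ hρ hij h
  refine le_trans ?_ (measureReal_mono hsub)
  have hE := measurableSet_pairFree hR r
  rw [← map_measureReal_apply_of_aemeasurable
    (aemeasurable_pi_lambda _ fun i => (hlaw i).aemeasurable) hE.compl, hmap,
    probReal_compl_eq_one_sub hE, tailBound]
  exact sub_le_sub_left (measureReal_pairFree_le hR (fun _ _ => Close.symm)
    (ae_stdGaussian_close m _) r) _

theorem closeRadius_pow {m : ℕ} (hm : 0 < m) {r : ℕ} {α : ℝ} :
    closeRadius m r α ^ m = √2 ^ m * (α ^ m)⁻¹ / (r : ℝ) ^ 2 := by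
  have h : ((r : ℝ) ^ (2 / (m : ℝ))) ^ m = (r : ℝ) ^ 2 := by
    rw [← Real.rpow_natCast, ← Real.rpow_mul (Nat.cast_nonneg r),
      div_mul_cancel₀ _ (by positivity), Real.rpow_two]
  rw [closeRadius, div_pow, mul_pow, h]
  ring

theorem tendsto_closeRadius {m : ℕ} (hm : 0 < m) {α : ℝ} (hα : 0 < α) :
    Tendsto (fun r => closeRadius m r α) atTop (𝓝[>] 0) := by
  refine tendsto_nhdsWithin_iff.2 ⟨?_, ?_⟩
  · exact (((tendsto_rpow_atTop (by positivity : 0 < 2 / (m : ℝ))).comp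
      tendsto_natCast_atTop_atTop).const_mul_atTop hα).const_div_atTop _
  · filter_upwards [eventually_gt_atTop 0] with r hr
    rw [Set.mem_Ioi, closeRadius]
    positivity

theorem tendsto_tailBound {m : ℕ} (hm : 0 < m) {α : ℝ} (hα : 0 < α) :
    Tendsto (fun r => tailBound m r α) atTop
      (𝓝 (1 - Real.exp (-(constK (m + 1) * (α ^ m)⁻¹)))) := by
  set L := coneConst m * (1 / 2 : ℝ) ^ (-((m : ℝ) + 1) / 2)
  set D := √2 ^ m * (α ^ m)⁻¹
  set q : ℕ → ℝ := fun r => coneProb m (closeRadius m r α) / closeRadius m r α ^ m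
  have hq : Tendsto q atTop (𝓝 L) :=
    (tendsto_coneProb_div_pow hm).comp (tendsto_closeRadius hm hα)
  have hinv : Tendsto (fun r : ℕ => ((r : ℝ))⁻¹) atTop (𝓝 0) := tendsto_inv_atTop_nhds_zero_nat
  have hp : ∀ r : ℕ, 0 < r → coneProb m (closeRadius m r α) = q r * (D / (r : ℝ) ^ 2) := by
    intro r hr
    have : 0 < closeRadius m r α := by rw [closeRadius]; positivity
    rw [← closeRadius_pow hm, div_mul_cancel₀ _ (by positivity)]
  have h1 : Tendsto (fun r : ℕ => (r : ℝ) * (r - 1) / 2 * coneProb m (closeRadius m r α)) atTop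
      (𝓝 (constK (m + 1) * (α ^ m)⁻¹)) := by
    have h : Tendsto (fun r : ℕ => q r * (D / 2) * (1 - (r : ℝ)⁻¹)) atTop
        (𝓝 (L * (D / 2) * (1 - 0))) := (hq.mul_const _).mul (hinv.const_sub 1)
    rw [constK_eq, show L * (√2 ^ m / 2) * (α ^ m)⁻¹ = L * (D / 2) * (1 - 0) by ring]
    refine h.congr' ?_
    filter_upwards [eventually_gt_atTop 0] with r hr
    rw [hp r hr]
    field_simp
  -- `r³ p² = (r² p)² / r`, where `r² p` is bounded.
  have h2 : Tendsto (fun r : ℕ => (r : ℝ) ^ 3 * coneProb m (closeRadius m r α) ^ 2) atTop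
      (𝓝 0) := by
    have h : Tendsto (fun r : ℕ => (q r * D) ^ 2 * (r : ℝ)⁻¹) atTop (𝓝 ((L * D) ^ 2 * 0)) :=
      ((hq.mul_const _).pow 2).mul hinv
    rw [mul_zero] at h
    refine h.congr' ?_
    filter_upwards [eventually_gt_atTop 0] with r hr
    rw [hp r hr]
    field_simp
  simpa [tailBound] using
    (((Real.continuous_exp.tendsto _).comp h1.neg).add h2).const_sub 1

theorem constK_two : constK 2 = 1 / (√2 * Real.pi) := by
  have h1 : Real.Gamma (3 / 2) = 1 / 2 * √Real.pi := by
    rw [← Real.Gamma_one_half_eq, ← Real.Gamma_add_one (by norm_num)]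
    norm_num
  have h2 : (2 : ℝ) ^ ((2 - 5) / 2 : ℝ) = √2 / 4 := by
    rw [show ((2 - 5) / 2 : ℝ) = 1 / 2 - 2 by norm_num, Real.rpow_sub two_pos,
      ← Real.sqrt_eq_rpow]
    norm_num
  have hπ : 0 < √Real.pi := Real.sqrt_pos.2 Real.pi_pos
  rw [constK]
  push_cast
  rw [h2, div_self two_ne_zero, Real.Gamma_one, show ((2 : ℝ) + 1) / 2 = 3 / 2 by norm_num, h1]
  field_simp
  rw [Real.sq_sqrt Real.pi_pos.le, Real.sq_sqrt zero_le_two]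
  ring

theorem isEquivalent_one_sub_exp_neg :
    (fun x : ℝ => 1 - Real.exp (-x)) ~[𝓝 0] fun x => x := by
  have h : HasDerivAt (fun x : ℝ => 1 - Real.exp (-x)) 1 0 := by
    simpa using ((hasDerivAt_neg (0 : ℝ)).exp).const_sub 1
  have := h.isLittleO
  simpa [IsEquivalent, Pi.sub_def] using this

theorem theorem1p2 (m₃ : ℕ) (hm₃ : 2 ≤ m₃) :
    ∃ T : ℕ → ℝ → ℝ,
      (∀ α : ℝ, 0 < α → ∀ (r m₁ m₂ : ℕ)
        (a : Fin r → EuclideanSpace ℝ (Fin m₁)) (b : Fin r → EuclideanSpace ℝ (Fin m₂))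
        {Ω : Type u} [MeasurableSpace Ω] (P : Measure Ω) [IsProbabilityMeasure P]
        (c : Fin r → Ω → EuclideanSpace ℝ (Fin m₃)),
        iIndepFun c P →
        (∀ i, HasLaw (c i) (stdGaussian (EuclideanSpace ℝ (Fin m₃))) P) →
        T r α ≤ P.real {ω | ENNReal.ofReal (α * (r : ℝ) ^ (2 / ((m₃ : ℝ) - 1))) ≤
          condNumber (cpdTuple a b fun i => c i ω)}) ∧
      (∀ α : ℝ, 0 < α →
        Tendsto (fun r => T r α) atTop
          (𝓝 (1 - Real.exp (-(constK m₃ * α ^ (1 - (m₃ : ℝ))))))) ∧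
      (m₃ = 2 →
        (∀ α : ℝ, 0 < α → ∀ (r m₁ m₂ : ℕ)
          (a : Fin r → EuclideanSpace ℝ (Fin m₁)) (b : Fin r → EuclideanSpace ℝ (Fin m₂))
          {Ω : Type u} [MeasurableSpace Ω] (P : Measure Ω) [IsProbabilityMeasure P]
          (c : Fin r → Ω → EuclideanSpace ℝ (Fin m₃)),
          iIndepFun c P →
          (∀ i, HasLaw (c i) (stdGaussian (EuclideanSpace ℝ (Fin m₃))) P) →
          T r α ≤ P.real {ω | ENNReal.ofReal (α * (r : ℝ) ^ 2) ≤
            condNumber (cpdTuple a b fun i => c i ω)}) ∧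
        (∀ α : ℝ, 0 < α →
          Tendsto (fun r => T r α) atTop
            (𝓝 (1 - Real.exp (-(1 / (√2 * Real.pi * α)))))) ∧
        (fun α : ℝ => 1 - Real.exp (-(1 / (√2 * Real.pi * α)))) ~[atTop]
          (fun α : ℝ => 1 / (√2 * Real.pi * α))) := by
  obtain ⟨m, rfl⟩ : ∃ m, m₃ = m + 1 := ⟨m₃ - 1, by omega⟩
  have hm : 0 < m := by omega
  refine ⟨tailBound m, ?_, ?_, ?_⟩
  · intro α hα r m₁ m₂ a b Ω _ P _ c hc hlaw
    simpa using tailBound_le m hα a b P c hc hlaw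
  · intro α hα
    have := tendsto_tailBound hm hα
    rwa [← Real.rpow_natCast, ← Real.rpow_neg hα.le,
      show -(m : ℝ) = 1 - ((m + 1 : ℕ) : ℝ) by push_cast; ring] at this
  · intro h2
    obtain rfl : m = 1 := by omega
    refine ⟨?_, ?_, ?_⟩
    · intro α hα r m₁ m₂ a b Ω _ P _ c hc hlaw
      simpa using tailBound_le 1 hα a b P c hc hlaw
    · intro α hα
      have := tendsto_tailBound one_pos hα
      rwa [constK_two, pow_one, ← one_div, div_mul_div_comm, one_mul] at this
    · refine isEquivalent_one_sub_exp_neg.comp_tendsto ?_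
      exact (tendsto_id.const_mul_atTop (by positivity)).const_div_atTop 1
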